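/- Let $X$ be a reflexive real Banach space whose dual $X^*$ is separable, let $[t_0,T]\subset\mathbb R$, and let $(\Omega,\mathcal F,(\mathcal F_t)_{t\in[t_0,T]},\mathbb P)$ be a filtered probability space satisfying the usual conditions (each $\mathcal F_t$ contains all $\mathbb P$-null sets, in particular $\mathcal F$ is $\mathbb P$-complete, and the filtration is right-continuous). A map $F$ from a measurable space $(S,\mathcal S)$ to the subsets of $X$ is called $\mathcal S$-measurable if $\{s\in S: F(s)\cap O\neq\emptyset\}\in\mathcal S$ for every open $O\subseteq X$; a random closed set is an $\mathcal F$-measurable map from $\Omega$ to the non-empty closed subsets of $X$. Let $\mathcal P$ be the predictable $\sigma$-algebra on $\Omega\times[t_0,T]$, i.e. the $\sigma$-algebra generated by all processes $H:\Omega\times[t_0,T]\to\{\text{non-empty closed subsets of }X\}$ that are adapted ($H(\cdot,t)$ is $\mathcal F_t$-measurable for every $t$) and whose trajectories are almost surely left-continuous with respect to the Hausdorff distance. Let $G$ map $\Omega\times[t_0,T]$ to the closed subsets of $X$ and suppose that 1. $0\in G(\omega,t)$ for all $(\omega,t)$; 2. $G(\omega,t)$ is convex for all $(\omega,t)$; 3.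 there is a non-empty closed bounded set $K\subseteq X$ with $G(\omega,t)\subseteq K$ for all $(\omega,t)$; 4. $G$ is $\mathcal P$-measurable. For $a\le b$ in $[t_0,T]$ let $$\int_a^b G(\omega,\tau)\,d\tau=\Big\{\int_a^b g(\tau)\,d\tau:\ g\in L^1([t_0,T];X),\ g(\tau)\in G(\omega,\tau)\text{ for a.e. }\tau\in[t_0,T]\Big\}$$ be the Aumann integral with respect to Lebesgue measure (the integrals on the right being Bochner integrals), and for $b<a$ put $\int_a^b G(\omega,\tau)\,d\tau=-\int_b^a G(\omega,\tau)\,d\tau$. Then, for all $a,b\in[t_0,T]$, the set $\int_a^b G(\omega,\tau)\,d\tau$ is non-empty for every $\omega\in\Omega$ and the set-valued map $\omega\mapsto G_{a,b}(\omega)=\int_a^b G(\omega,\tau)\,d\tau$ is $\mathcal F$-measurable. Moreover $G_{a,b}$ is a random closed set with bounded convex values: for every $\omega$, $G_{a,b}(\omega)$ is non-empty, closed, bounded and convex. -/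

import Mathlib

open MeasureTheory Set Filter Topology
open scoped Pointwise ENNReal

noncomputable section

/-- A real normed space is reflexive if the canonical map into its bidual is onto. -/
def IsReflexiveSpace (X : Type*) [NormedAddCommGroup X] [NormedSpace ℝ X] : Prop :=
  Function.Surjective (NormedSpace.inclusionInDoubleDual ℝ X)

/-- A set-valued map `F : S → Set X` is measurable with respect to the σ-algebra `m` on `S` if
`{s | F s ∩ O ≠ ∅}` belongs to `m` for every open `O ⊆ X`. -/
def IsMeasurableSetMap {S X : Type*} [TopologicalSpace X] (m : MeasurableSpace S)
    (F : S → Set X) : Prop :=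
  ∀ O : Set X, IsOpen O → MeasurableSet[m] {s | (F s ∩ O).Nonempty}

/-- A random closed set: a measurable map whose values are non-empty closed sets. -/
structure IsRandomClosedSet {Ω X : Type*} [TopologicalSpace X] (m : MeasurableSpace Ω)
    (F : Ω → Set X) : Prop where
  nonempty : ∀ ω, (F ω).Nonempty
  isClosed : ∀ ω, IsClosed (F ω)
  measurable : IsMeasurableSetMap m F

/-- The usual conditions on a filtration: each of its σ-algebras contains every `P`-null set
(`P s` is the outer measure when `s` is not known to be measurable, so the underlying space is
complete as well), and it is right-continuous. -/
structure HasUsualConditions {Ω ι : Type*} [PartialOrder ι] {m : MeasurableSpace Ω}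
    (𝓕 : Filtration ι m) (P : Measure Ω) : Prop where
  null_mem : ∀ (t : ι) (s : Set Ω), P s = 0 → MeasurableSet[𝓕 t] s
  rightContinuous : 𝓕.IsRightContinuous

/-- `H` is an adapted process with non-empty closed values in `X` which almost surely has
trajectories that are left-continuous for the (extended) Hausdorff distance. -/
structure IsLeftContinuousAdapted {Ω ι : Type*} (X : Type*) [NormedAddCommGroup X]
    [PartialOrder ι] [TopologicalSpace ι] {m : MeasurableSpace Ω}
    (𝓕 : Filtration ι m) (P : Measure Ω) (H : Ω → ι → Set X) : Prop where
  adapted : ∀ t, IsRandomClosedSet (𝓕 t) (fun ω => H ω t)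
  leftContinuous : ∀ᵐ ω ∂P, ∀ u : ι,
    Tendsto (fun t => Metric.hausdorffEDist (H ω t) (H ω u)) (𝓝[<] u) (𝓝 0)

/-- The predictable σ-algebra on `Ω × ι`: the smallest σ-algebra for which every left-continuous
adapted process with non-empty closed values in `X` is measurable. -/
@[reducible]
def predictableSigmaAlgebra {Ω ι : Type*} (X : Type*) [NormedAddCommGroup X]
    [PartialOrder ι] [TopologicalSpace ι] {m : MeasurableSpace Ω}
    (𝓕 : Filtration ι m) (P : Measure Ω) : MeasurableSpace (Ω × ι) :=
  MeasurableSpace.generateFrom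
    {A | ∃ (H : Ω → ι → Set X) (O : Set X), IsLeftContinuousAdapted X 𝓕 P H ∧ IsOpen O ∧
      A = {p : Ω × ι | (H p.1 p.2 ∩ O).Nonempty}}

/-- The Aumann integral `∫_A F dμ`: all Bochner integrals over `A` of the `μ`-integrable
selections of `F`. -/
def aumannIntegral {S X : Type*} [NormedAddCommGroup X] [NormedSpace ℝ X] [MeasurableSpace S]
    (μ : Measure S) (F : S → Set X) (A : Set S) : Set X :=
  {y | ∃ x : S → X, Integrable x μ ∧ (∀ᵐ s ∂μ, x s ∈ F s) ∧ ∫ s in A, x s ∂μ = y}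

/-- Lebesgue measure on the interval `[t₀, T]`. -/
def lebesgueIcc (t₀ T : ℝ) : Measure (Icc t₀ T) :=
  Measure.comap Subtype.val volume

open scoped Classical in
/-- The Aumann integral `∫_a^b F(τ) dτ` with respect to Lebesgue measure on `[t₀, T]`, with the
usual orientation `∫_a^b = -∫_b^a` when `b < a`. -/
def aumannIntervalIntegral {X : Type*} [NormedAddCommGroup X] [NormedSpace ℝ X] {t₀ T : ℝ}
    (F : Icc t₀ T → Set X) (a b : Icc t₀ T) : Set X :=
  if a ≤ b then aumannIntegral (lebesgueIcc t₀ T) F (Icc a b)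
  else -aumannIntegral (lebesgueIcc t₀ T) F (Icc b a)

end

/-! Non-emptiness, convexity and boundedness are inherited pointwise: the zero function is a
selection, selections can be averaged, and their integrals are bounded. The two real points are
closedness and measurability.

Closedness: for `y` in the closure, the selections whose integral is nearly `y` form decreasing
convex sets. Pairing with a dense sequence of functionals embeds them linearly in a Hilbert space,
where the parallelogram law yields a Cauchy sequence of such selections. Along a subsequence all
these scalar functions converge almost everywhere. Reflexivity turns this into a weak limit, which
lies in the closed convex value `F s` by Hahn–Banach, and dominated convergence, tested on
functionals, identifies its integral as `y`.

Measurability: a bounded convex set meets a ball exactly when countably many inequalities for its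
support function hold. Near-optimal measurable selections show that the support function of the
integral is the integral of the support functions, which is measurable in `ω` by Fubini once `G` is
jointly measurable. Predictability gives joint measurability outside a null set of scenarios, since
left-continuous processes are limits of their values on countable grids. Completeness of `P` then
absorbs the null set. -/

/-! ### Separability and measurable selections -/

/-- A normed space with separable dual is separable. -/
theorem separableSpace_of_separableSpace_dual {X : Type*} [NormedAddCommGroup X] [NormedSpace ℝ X]
    [TopologicalSpace.SeparableSpace (StrongDual ℝ X)] : TopologicalSpace.SeparableSpace X := by
  -- Almost norming vectors for a dense sequence of functionals; a functional vanishing on all of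
  -- them must be zero.
  have hx : ∀ n : ℕ, ∃ x : X, ‖x‖ ≤ 1 ∧
      ‖TopologicalSpace.denseSeq (StrongDual ℝ X) n‖ / 2 ≤
        TopologicalSpace.denseSeq (StrongDual ℝ X) n x := by
    intro n
    set f := TopologicalSpace.denseSeq (StrongDual ℝ X) n
    rcases eq_or_ne f 0 with h | h
    · exact ⟨0, by simp, by simp [h]⟩
    · obtain ⟨x, hx1, hx2⟩ := f.exists_lt_apply_of_lt_opNorm
        (half_lt_self (norm_pos_iff.2 h))
      rcases le_total 0 (f x) with h0 | h0
      · exact ⟨x, hx1.le, by rw [Real.norm_of_nonneg h0] at hx2; exact hx2.le⟩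
      · refine ⟨-x, by simpa using hx1.le, ?_⟩
        rw [Real.norm_of_nonpos h0] at hx2
        simpa using hx2.le
  choose x hx1 hx2 using hx
  have hsep : TopologicalSpace.IsSeparable (Submodule.span ℝ (range x) : Set X) :=
    (countable_range x).isSeparable.span
  have hdense : Dense (Submodule.span ℝ (range x) : Set X) := by
    rw [Submodule.dense_iff_topologicalClosure_eq_top]
    by_contra hne
    obtain ⟨z, hz⟩ : ∃ z, z ∉ (Submodule.span ℝ (range x)).topologicalClosure := by
      by_contra! h
      exact hne (eq_top_iff.2 fun z _ => h z)
    obtain ⟨f, u, hfu, huz⟩ := geometric_hahn_banach_closed_point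
      (Submodule.span ℝ (range x)).topologicalClosure.convex
      (Submodule.isClosed_topologicalClosure _) hz
    -- A functional bounded above on a subspace vanishes there: the multiple with `c = u / f (x n)`
    -- would take the forbidden value `u`.
    have hvan : ∀ n, f (x n) = 0 := by
      intro n
      have hmem : ∀ c : ℝ, c • x n ∈ (Submodule.span ℝ (range x)).topologicalClosure := fun c =>
        Submodule.smul_mem _ _ (Submodule.le_topologicalClosure _
          (Submodule.subset_span (mem_range_self n)))
      by_contra h0
      have := hfu _ (hmem (u / f (x n)))
      rw [map_smul, smul_eq_mul, div_mul_cancel₀ _ h0] at this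
      exact lt_irrefl _ this
    have hf0 : f ≠ 0 := by
      rintro rfl
      have := hfu 0 (Submodule.zero_mem _)
      simp at this huz
      linarith
    have hpos : 0 < ‖f‖ := norm_pos_iff.2 hf0
    obtain ⟨n, hn⟩ := (TopologicalSpace.denseRange_denseSeq (StrongDual ℝ X)).exists_dist_lt f
      (show 0 < ‖f‖ / 4 by positivity)
    set g := TopologicalSpace.denseSeq (StrongDual ℝ X) n
    rw [dist_eq_norm] at hn
    have h1 : ‖g‖ / 2 ≤ ‖f - g‖ := by
      have h2 : g (x n) = -((f - g) (x n)) := by simp [hvan n]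
      have h3 := (f - g).le_opNorm (x n)
      have h4 : ‖f - g‖ * ‖x n‖ ≤ ‖f - g‖ :=
        mul_le_of_le_one_right (norm_nonneg _) (hx1 n)
      have h5 := neg_le_abs ((f - g) (x n))
      rw [Real.norm_eq_abs] at h3
      linarith [hx2 n]
    have h6 := norm_sub_norm_le f g
    linarith
  have := hsep.closure
  rw [hdense.closure_eq] at this
  exact TopologicalSpace.isSeparable_univ_iff.1 this

/-- The Kuratowski–Ryll-Nardzewski measurable selection theorem. -/
theorem IsMeasurableSetMap.exists_measurable_selection {S X : Type*} [m : MeasurableSpace S]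
    [MetricSpace X] [CompleteSpace X] [TopologicalSpace.SeparableSpace X] [MeasurableSpace X]
    [BorelSpace X] {F : S → Set X} (hF : IsMeasurableSetMap m F)
    (hne : ∀ s, (F s).Nonempty) (hcl : ∀ s, IsClosed (F s)) :
    ∃ g : S → X, Measurable g ∧ ∀ s, g s ∈ F s := by
  classical
  rcases isEmpty_or_nonempty S with hS | ⟨⟨s₀⟩⟩
  · exact ⟨fun s => (hS.false s).elim, measurable_of_empty _, fun s => (hS.false s).elim⟩
  have : Nonempty X := ⟨(hne s₀).some⟩
  let d := TopologicalSpace.denseSeq X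
  have hd : DenseRange d := TopologicalSpace.denseRange_denseSeq X
  have hstart : ∃ κ : S → ℕ, Measurable κ ∧ ∀ s, (F s ∩ Metric.ball (d (κ s)) 1).Nonempty := by
    have hex : ∀ s, ∃ k, (F s ∩ Metric.ball (d k) 1).Nonempty := fun s => by
      obtain ⟨y, hy⟩ := hne s
      obtain ⟨k, hk⟩ := hd.exists_dist_lt y one_pos
      exact ⟨k, y, hy, hk⟩
    exact ⟨fun s => Nat.find (hex s), measurable_find hex fun k => hF _ Metric.isOpen_ball,
      fun s => Nat.find_spec (hex s)⟩
  -- The next ball must meet `F s` inside the previous one; this keeps successive centres close and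
  -- makes them a Cauchy sequence.
  have hstep : ∀ (ε δ : ℝ), 0 < δ → ∀ κ : S → ℕ, Measurable κ →
      (∀ s, (F s ∩ Metric.ball (d (κ s)) ε).Nonempty) → ∃ κ' : S → ℕ, Measurable κ' ∧
      ∀ s, (F s ∩ (Metric.ball (d (κ s)) ε ∩ Metric.ball (d (κ' s)) δ)).Nonempty := by
    intro ε δ hδ κ hκ hκF
    have hex : ∀ s, ∃ k, (F s ∩ (Metric.ball (d (κ s)) ε ∩ Metric.ball (d k) δ)).Nonempty := by
      intro s
      obtain ⟨y, hy, hyb⟩ := hκF s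
      obtain ⟨k, hk⟩ := hd.exists_dist_lt y hδ
      exact ⟨k, y, hy, hyb, hk⟩
    refine ⟨fun s => Nat.find (hex s), measurable_find hex fun k => ?_,
      fun s => Nat.find_spec (hex s)⟩
    -- The ball depends on `s` only through the integer `κ s`, so the set splits over countably many
    -- fixed balls.
    have : {s | (F s ∩ (Metric.ball (d (κ s)) ε ∩ Metric.ball (d k) δ)).Nonempty} =
        ⋃ i, κ ⁻¹' {i} ∩ {s | (F s ∩ (Metric.ball (d i) ε ∩ Metric.ball (d k) δ)).Nonempty} := by
      ext s
      simp
    rw [this]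
    exact .iUnion fun i => (hκ (measurableSet_singleton i)).inter
      (hF _ (Metric.isOpen_ball.inter Metric.isOpen_ball))
  choose! next hnext_meas hnext using hstep
  obtain ⟨κ₀, hκ₀, hκ₀F⟩ := hstart
  let κ : ℕ → S → ℕ := fun n => Nat.rec κ₀ (fun n κ => next ((1 / 2) ^ n) ((1 / 2) ^ (n + 1)) κ) n
  have hκ : ∀ n, Measurable (κ n) ∧
      ∀ s, (F s ∩ Metric.ball (d (κ n s)) ((1 / 2 : ℝ) ^ n)).Nonempty := by
    intro n
    induction n with
    | zero => exact ⟨hκ₀, fun s => by rw [pow_zero]; exact hκ₀F s⟩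
    | succ n ih =>
      have hp : (0 : ℝ) < (1 / 2) ^ (n + 1) := by positivity
      exact ⟨hnext_meas _ _ hp _ ih.1 ih.2, fun s =>
        (hnext ((1 / 2) ^ n) _ hp _ ih.1 ih.2 s).mono fun y hy => ⟨hy.1, hy.2.2⟩⟩
  have hdist : ∀ s n, dist (d (κ n s)) (d (κ (n + 1) s)) ≤ 2 * (1 / 2 : ℝ) ^ n := by
    intro s n
    have hp : (0 : ℝ) < (1 / 2) ^ (n + 1) := by positivity
    obtain ⟨y, -, hy1, hy2⟩ := hnext ((1 / 2) ^ n) _ hp _ (hκ n).1 (hκ n).2 s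
    have h1 := dist_triangle_left (d (κ n s)) (d (κ (n + 1) s)) y
    have h2 : dist y (d (κ (n + 1) s)) < (1 / 2 : ℝ) ^ (n + 1) := hy2
    rw [Metric.mem_ball] at hy1
    rw [pow_succ] at h2 hp
    linarith
  have hlim : ∀ s, ∃ x, Tendsto (fun n => d (κ n s)) atTop (𝓝 x) := fun s =>
    cauchySeq_tendsto_of_complete (cauchySeq_of_le_geometric _ _ (by norm_num) (hdist s))
  choose g hg using hlim
  refine ⟨g, measurable_of_tendsto_metrizable
    (fun n => (measurable_from_nat (f := d)).comp (hκ n).1) (tendsto_pi_nhds.2 hg), fun s => ?_⟩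
  choose y hyF hyb using fun n => (hκ n).2 s
  have hy0 : Tendsto (fun n => dist (d (κ n s)) (y n)) atTop (𝓝 0) :=
    squeeze_zero (fun _ => dist_nonneg) (fun n => by rw [dist_comm]; exact (hyb n).le)
      (tendsto_pow_atTop_nhds_zero_of_lt_one (by norm_num) (by norm_num))
  exact (hcl s).mem_of_tendsto ((tendsto_iff_of_dist hy0).1 (hg s)) (.of_forall hyF)

/-! ### Weak limits and closedness of the Aumann integral -/

/-- From a decreasing sequence of non-empty bounded convex sets in an inner product space one can
select a Cauchy sequence. -/
theorem exists_cauchySeq_mem_of_antitone_convex {E : Type*} [NormedAddCommGroup E]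
    [InnerProductSpace ℝ E] {D : ℕ → Set E} (hD : Antitone D) (hne : ∀ n, (D n).Nonempty)
    (hconv : ∀ n, Convex ℝ (D n)) {R : ℝ} (hR : ∀ v ∈ D 0, ‖v‖ ≤ R) :
    ∃ w : ℕ → E, (∀ n, w n ∈ D n) ∧ CauchySeq w := by
  -- The minimal squared norms increase to a limit `L`, and near-minimizers are Cauchy because
  -- midpoints of `w n` and `w N` stay in `D N`. No set `D n` has to be closed.
  let δ : ℕ → ℝ := fun n => sInf ((fun v => ‖v‖ ^ 2) '' D n)
  have hbdd : ∀ n, BddBelow ((fun v : E => ‖v‖ ^ 2) '' D n) := fun n =>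
    ⟨0, by rintro _ ⟨v, -, rfl⟩; positivity⟩
  have hδle : ∀ n, ∀ v ∈ D n, δ n ≤ ‖v‖ ^ 2 := fun n v hv => csInf_le (hbdd n) ⟨v, hv, rfl⟩
  have hmono : Monotone δ := fun i j hij =>
    csInf_le_csInf (hbdd i) ((hne j).image _) (image_mono (hD hij))
  have hbound : BddAbove (range δ) := by
    refine ⟨R ^ 2, ?_⟩
    rintro _ ⟨n, rfl⟩
    obtain ⟨v, hv⟩ := hne n
    exact (hδle n v hv).trans
      (pow_le_pow_left₀ (norm_nonneg _) (hR v (hD (Nat.zero_le n) hv)) 2)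
  have hδlim := tendsto_atTop_ciSup hmono hbound
  set L := ⨆ n, δ n
  have hδL : ∀ n, δ n ≤ L := fun n => le_ciSup hbound n
  have hw : ∀ n : ℕ, ∃ v ∈ D n, ‖v‖ ^ 2 < δ n + 1 / ((n : ℝ) + 1) := by
    intro n
    obtain ⟨_, ⟨v, hv, rfl⟩, hlt⟩ := exists_lt_of_csInf_lt ((hne n).image fun v : E => ‖v‖ ^ 2)
      (show δ n < δ n + 1 / ((n : ℝ) + 1) by have : 0 < 1 / ((n : ℝ) + 1) := by positivity
                                             linarith)
    exact ⟨v, hv, hlt⟩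
  choose w hwD hw using hw
  refine ⟨w, hwD, ?_⟩
  have hkey : ∀ N n, N ≤ n →
      ‖w n - w N‖ ^ 2 ≤ 4 * (L - δ N) + 4 * (1 / ((N : ℝ) + 1)) := by
    intro N n hNn
    have hmid : (1 / 2 : ℝ) • w n + (1 / 2 : ℝ) • w N ∈ D N :=
      hconv N (hD hNn (hwD n)) (hwD N) (by norm_num) (by norm_num) (by norm_num)
    have h1 := hδle N _ hmid
    rw [← smul_add, norm_smul, mul_pow] at h1
    have h2 := parallelogram_law_with_norm ℝ (w n) (w N)
    have h3 : 1 / ((n : ℝ) + 1) ≤ 1 / ((N : ℝ) + 1) := by gcongr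
    have h4 := hw n
    have h5 := hw N
    have h6 := hδL n
    have h7 : ‖(1 / 2 : ℝ)‖ ^ 2 = 1 / 4 := by norm_num
    rw [h7] at h1
    nlinarith [hδL N]
  have hzero : Tendsto (fun N : ℕ => 4 * (L - δ N) + 4 * (1 / ((N : ℝ) + 1))) atTop (𝓝 0) := by
    have := ((tendsto_const_nhds (x := L)).sub hδlim).const_mul 4 |>.add
      (tendsto_one_div_add_atTop_nhds_zero_nat.const_mul (4 : ℝ))
    simpa using this
  rw [Metric.cauchySeq_iff']
  intro ε hε
  obtain ⟨N, hN⟩ := ((tendsto_order.1 hzero).2 (ε ^ 2) (by positivity)).exists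
  refine ⟨N, fun n hn => ?_⟩
  rw [dist_eq_norm]
  exact lt_of_pow_lt_pow_left₀ 2 hε.le ((hkey N n hn).trans_lt hN)

/-- In a reflexive space, a bounded sequence along which densely many functionals converge has a
weak limit. -/
theorem IsReflexiveSpace.exists_weak_limit {X : Type*} [NormedAddCommGroup X] [NormedSpace ℝ X]
    (hrefl : IsReflexiveSpace X) {ι : Type*} {f : ι → StrongDual ℝ X} (hf : DenseRange f)
    {x : ℕ → X} {R : ℝ} (hR : ∀ n, ‖x n‖ ≤ R)
    (hx : ∀ i, ∃ c, Tendsto (fun n => f i (x n)) atTop (𝓝 c)) :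
    ∃ y : X, ∀ φ : StrongDual ℝ X, Tendsto (fun n => φ (x n)) atTop (𝓝 (φ y)) := by
  have hlim : ∀ φ : StrongDual ℝ X, ∃ c, Tendsto (fun n => φ (x n)) atTop (𝓝 c) := by
    intro φ
    apply cauchySeq_tendsto_of_complete
    rw [Metric.cauchySeq_iff']
    intro ε hε
    have hR0 : 0 ≤ R := (norm_nonneg _).trans (hR 0)
    obtain ⟨i, hi⟩ := hf.exists_dist_lt φ (show 0 < ε / (4 * (R + 1)) by positivity)
    obtain ⟨c, hc⟩ := hx i
    obtain ⟨N, hN⟩ := Metric.cauchySeq_iff'.1 hc.cauchySeq (ε / 2) (by positivity)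
    refine ⟨N, fun n hn => ?_⟩
    have hclose : ∀ k, dist (φ (x k)) (f i (x k)) < ε / 4 := by
      intro k
      rw [dist_eq_norm, ← sub_apply]
      rw [dist_eq_norm] at hi
      calc ‖(φ - f i) (x k)‖ ≤ ‖φ - f i‖ * ‖x k‖ := (φ - f i).le_opNorm _
        _ ≤ ‖φ - f i‖ * (R + 1) := by gcongr; linarith [hR k]
        _ < ε / (4 * (R + 1)) * (R + 1) := by gcongr
        _ = ε / 4 := by field_simp
    have h1 := hclose n
    have h2 := hclose N
    have h3 := hN n hn
    have h4 := dist_triangle4 (φ (x n)) (f i (x n)) (f i (x N)) (φ (x N))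
    rw [dist_comm (f i (x N))] at h4
    linarith
  choose Λ hΛ using hlim
  have htend : Tendsto (fun n φ => NormedSpace.inclusionInDoubleDual ℝ X (x n) φ) atTop (𝓝 Λ) :=
    tendsto_pi_nhds.2 hΛ
  -- By Banach–Steinhaus the pointwise limit of the evaluations is a continuous functional on the
  -- dual, which reflexivity represents by a vector.
  obtain ⟨y, hy⟩ := hrefl (continuousLinearMapOfTendsto
    (fun n => NormedSpace.inclusionInDoubleDual ℝ X (x n)) htend)
  refine ⟨y, fun φ => ?_⟩
  have : φ y = Λ φ := by
    rw [← NormedSpace.dual_def ℝ X y φ, hy]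
    rfl
  rw [this]
  exact hΛ φ

/-- The coordinate map of a dense sequence of functionals on a separable Banach space is a
measurable embedding. -/
theorem measurableEmbedding_of_denseRange_dual {X : Type*} [NormedAddCommGroup X]
    [NormedSpace ℝ X] [CompleteSpace X] [TopologicalSpace.SeparableSpace X] [MeasurableSpace X]
    [BorelSpace X] {f : ℕ → StrongDual ℝ X} (hf : DenseRange f) :
    MeasurableEmbedding (fun x : X => fun j => f j x) := by
  have : SecondCountableTopology X := UniformSpace.secondCountable_of_separable X
  -- Lusin–Souslin: a continuous injection of a Polish space is a Borel embedding. Injectivity holds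
  -- because a dense set of functionals separates points.
  refine Continuous.measurableEmbedding (continuous_pi fun j => (f j).continuous) ?_
  intro x y hxy
  rw [SeparatingDual.eq_iff_forall_dual_eq (R := ℝ)]
  intro φ
  refine congrFun (hf.equalizer (g := fun φ : StrongDual ℝ X => φ x)
    (h := fun φ : StrongDual ℝ X => φ y) (by fun_prop) (by fun_prop) ?_) φ
  funext j
  exact congrFun hxy j

theorem setIntegral_smul_add_smul {S X : Type*} [MeasurableSpace S] [NormedAddCommGroup X]
    [NormedSpace ℝ X] {μ : Measure S} {h k : S → X} (hh : Integrable h μ) (hk : Integrable k μ)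
    (A : Set S) (a b : ℝ) : ∫ s in A, (a • h + b • k) s ∂μ =
      a • ∫ s in A, h s ∂μ + b • ∫ s in A, k s ∂μ := by
  rw [integral_add' (hh.integrableOn.smul a) (hk.integrableOn.smul b)]
  simp only [Pi.smul_apply]
  rw [integral_smul, integral_smul]

theorem convex_aumannIntegral {S X : Type*} [MeasurableSpace S] [NormedAddCommGroup X]
    [NormedSpace ℝ X] (μ : Measure S) {F : S → Set X} (hconv : ∀ s, Convex ℝ (F s)) (A : Set S) :
    Convex ℝ (aumannIntegral μ F A) := by
  rintro _ ⟨h, hh, hhF, rfl⟩ _ ⟨k, hk, hkF, rfl⟩ a b ha hb hab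
  refine ⟨a • h + b • k, (hh.smul a).add (hk.smul b), ?_, setIntegral_smul_add_smul hh hk A a b⟩
  filter_upwards [hhF, hkF] with s h1 h2 using hconv s h1 h2 ha hb hab

theorem zero_mem_aumannIntegral {S X : Type*} [MeasurableSpace S] [NormedAddCommGroup X]
    [NormedSpace ℝ X] (μ : Measure S) {F : S → Set X} (h0 : ∀ s, (0 : X) ∈ F s) (A : Set S) :
    (0 : X) ∈ aumannIntegral μ F A :=
  ⟨fun _ => 0, integrable_zero _ _ _, .of_forall h0, by simp⟩

theorem norm_le_of_mem_aumannIntegral {S X : Type*} [MeasurableSpace S] [NormedAddCommGroup X]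
    [NormedSpace ℝ X] (μ : Measure S) [IsFiniteMeasure μ] {F : S → Set X} {R : ℝ}
    (hR : ∀ s, ∀ x ∈ F s, ‖x‖ ≤ R) (A : Set S) {y : X} (hy : y ∈ aumannIntegral μ F A) :
    ‖y‖ ≤ R * μ.real A := by
  obtain ⟨h, -, hhF, rfl⟩ := hy
  refine norm_setIntegral_le_of_norm_le_const_ae (measure_lt_top μ A) ?_
  filter_upwards [ae_restrict_of_ae hhF] with s hs using hR s _ hs

/-- The Aumann integral of a uniformly bounded map with closed convex values in a reflexive space
with separable dual is closed; no measurability of the map is needed. -/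
theorem isClosed_aumannIntegral {S X : Type*} [MeasurableSpace S] [NormedAddCommGroup X]
    [NormedSpace ℝ X] [CompleteSpace X] (hrefl : IsReflexiveSpace X)
    [TopologicalSpace.SeparableSpace (StrongDual ℝ X)] (μ : Measure S) [IsFiniteMeasure μ]
    {F : S → Set X} (hcl : ∀ s, IsClosed (F s)) (hconv : ∀ s, Convex ℝ (F s)) {R : ℝ}
    (hR : ∀ s, ∀ x ∈ F s, ‖x‖ ≤ R) (A : Set S) : IsClosed (aumannIntegral μ F A) := by
  have hsepX : TopologicalSpace.SeparableSpace X := separableSpace_of_separableSpace_dual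
  have : SecondCountableTopology X := UniformSpace.secondCountable_of_separable X
  borelize X
  refine isClosed_of_closure_subset fun y hy => ?_
  let C : ℕ → Set (S → X) := fun n => {h | Integrable h μ ∧ (∀ᵐ s ∂μ, h s ∈ F s) ∧
    ‖∫ s in A, h s ∂μ - y‖ ≤ 1 / ((n : ℝ) + 1)}
  have hCne : ∀ n, (C n).Nonempty := by
    intro n
    obtain ⟨_, ⟨h, h1, h2, rfl⟩, h3⟩ := Metric.mem_closure_iff.1 hy (1 / ((n : ℝ) + 1))
      (by positivity)
    rw [dist_comm, dist_eq_norm] at h3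
    exact ⟨h, h1, h2, h3.le⟩
  have hCanti : Antitone C := by
    intro i j hij h hh
    refine ⟨hh.1, hh.2.1, hh.2.2.trans ?_⟩
    gcongr
  have hCconv : ∀ n, Convex ℝ (C n) := by
    intro n h hh k hk a b ha hb hab
    refine ⟨(hh.1.smul a).add (hk.1.smul b), ?_, ?_⟩
    · filter_upwards [hh.2.1, hk.2.1] with s h1 h2 using hconv s h1 h2 ha hb hab
    · have h1 := setIntegral_smul_add_smul hh.1 hk.1 A a b
      have h2 : a • ∫ s in A, h s ∂μ + b • ∫ s in A, k s ∂μ - y =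
          a • (∫ s in A, h s ∂μ - y) + b • (∫ s in A, k s ∂μ - y) := by
        rw [smul_sub, smul_sub, sub_add_sub_comm, ← add_smul, hab, one_smul]
      rw [h1, h2]
      exact mem_closedBall_zero_iff.1 (convex_closedBall (0 : X) _ (mem_closedBall_zero_iff.2 hh.2.2)
        (mem_closedBall_zero_iff.2 hk.2.2) ha hb hab)
  let f := TopologicalSpace.denseSeq (StrongDual ℝ X)
  have hf : DenseRange f := TopologicalSpace.denseRange_denseSeq _
  -- Rescaling into the unit ball bounds all coordinates by `R` uniformly in `j`.
  let u : ℕ → StrongDual ℝ X := fun j => (‖f j‖ + 1)⁻¹ • f j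
  have hu : ∀ j, ‖u j‖ ≤ 1 := by
    intro j
    have h0 : 0 < ‖f j‖ + 1 := by positivity
    simp only [u]
    rw [norm_smul, norm_inv, Real.norm_of_nonneg h0.le, inv_mul_le_iff₀ h0]
    linarith
  -- A finite measure with the null sets of counting measure: bounded functions are square
  -- integrable, yet almost every `j` means every `j`.
  let ν : Measure ℕ := (Measure.count : Measure ℕ).toFinite
  let Φ : (S → X) → S × ℕ → ℝ := fun h p => u p.2 (h p.1)
  have hΦbound : ∀ h : S → X, (∀ᵐ s ∂μ, h s ∈ F s) → ∀ᵐ p ∂μ.prod ν, ‖Φ h p‖ ≤ R := by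
    intro h hh
    filter_upwards [Measure.quasiMeasurePreserving_fst.ae hh] with p hp
    exact ((u p.2).le_of_opNorm_le (hu p.2) _).trans (by simpa using hR _ _ hp)
  have hΦmeas : ∀ h : S → X, Integrable h μ → AEStronglyMeasurable (Φ h) (μ.prod ν) := by
    intro h hh
    obtain ⟨k, hk, hhk⟩ := hh.aestronglyMeasurable
    refine ⟨Φ k, (measurable_from_prod_countable_left fun j =>
      ((u j).continuous.measurable.comp hk.measurable)).stronglyMeasurable, ?_⟩
    filter_upwards [Measure.quasiMeasurePreserving_fst.ae hhk] with p hp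
    simp only [Φ, hp]
  have hΦmem : ∀ n, ∀ h ∈ C n, MemLp (Φ h) 2 (μ.prod ν) := fun n h hh =>
    .of_bound (hΦmeas h hh.1) R (hΦbound h hh.2.1)
  let D : ℕ → Set (Lp ℝ 2 (μ.prod ν)) := fun n => {v | ∃ h ∈ C n, v =ᵐ[μ.prod ν] Φ h}
  obtain ⟨w, hwD, hw⟩ : ∃ w : ℕ → Lp ℝ 2 (μ.prod ν), (∀ n, w n ∈ D n) ∧ CauchySeq w := by
    refine exists_cauchySeq_mem_of_antitone_convex (D := D) ?_ ?_ ?_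
      (R := (measureUnivNNReal (μ.prod ν) : ℝ) ^ (2 : ℝ≥0∞).toReal⁻¹ * max R 0) ?_
    · rintro i j hij v ⟨h, hh, hv⟩
      exact ⟨h, hCanti hij hh, hv⟩
    · intro n
      obtain ⟨h, hh⟩ := hCne n
      exact ⟨(hΦmem n h hh).toLp _, h, hh, MemLp.coeFn_toLp _⟩
    · rintro n v ⟨h, hh, hv⟩ v' ⟨k, hk, hv'⟩ a b ha hb hab
      refine ⟨a • h + b • k, hCconv n hh hk ha hb hab, ?_⟩
      filter_upwards [Lp.coeFn_add (a • v) (b • v'), Lp.coeFn_smul a v, Lp.coeFn_smul b v', hv,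
        hv'] with p h1 h2 h3 h4 h5
      rw [h1, Pi.add_apply, h2, h3, Pi.smul_apply, Pi.smul_apply, h4, h5]
      simp [Φ]
    · rintro v ⟨h, hh, hv⟩
      refine Lp.norm_le_of_ae_bound (le_max_right _ _) ?_
      filter_upwards [hv, hΦbound h hh.2.1] with p h1 h2
      rw [h1]
      exact h2.trans (le_max_left _ _)
  choose h hhC hwh using hwD
  obtain ⟨v, hv⟩ := cauchySeq_tendsto_of_complete hw
  obtain ⟨ns, hns, hae⟩ := (tendstoInMeasure_of_tendsto_Lp hv).exists_seq_tendsto_ae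
  have hconvΦ : ∀ᵐ s ∂μ, ∀ᵐ j ∂ν, ∃ c, Tendsto (fun i => u j (h (ns i) s)) atTop (𝓝 c) := by
    refine Measure.ae_ae_of_ae_prod (p := fun p : S × ℕ =>
      ∃ c, Tendsto (fun i => u p.2 (h (ns i) p.1)) atTop (𝓝 c)) ?_
    filter_upwards [hae, ae_all_iff.2 hwh] with p h1 h2
    refine ⟨_, h1.congr fun i => ?_⟩
    rw [h2 (ns i)]
  have hsel : ∀ᵐ s ∂μ, ∀ i, h (ns i) s ∈ F s := ae_all_iff.2 fun i => (hhC (ns i)).2.1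
  have hweak : ∀ᵐ s ∂μ, ∃ z : X, ∀ φ : StrongDual ℝ X,
      Tendsto (fun i => φ (h (ns i) s)) atTop (𝓝 (φ z)) := by
    filter_upwards [hconvΦ, hsel] with s h1 h2
    refine hrefl.exists_weak_limit hf (fun i => hR s _ (h2 i)) fun j => ?_
    have h3 : ∀ j, ∃ c, Tendsto (fun i => u j (h (ns i) s)) atTop (𝓝 c) := by
      have h4 : ∀ᵐ j ∂(Measure.count : Measure ℕ),
          ∃ c, Tendsto (fun i => u j (h (ns i) s)) atTop (𝓝 c) :=
        (absolutelyContinuous_toFinite (Measure.count : Measure ℕ)).ae_le h1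
      rwa [Measure.ae_count_iff] at h4
    obtain ⟨c, hc⟩ := h3 j
    refine ⟨(‖f j‖ + 1) * c, (hc.const_mul (‖f j‖ + 1)).congr fun i => ?_⟩
    have h0 : ‖f j‖ + 1 ≠ 0 := by positivity
    simp [u, h0]
  classical
  let g : S → X := fun s => if hs : ∃ z : X, ∀ φ : StrongDual ℝ X,
      Tendsto (fun i => φ (h (ns i) s)) atTop (𝓝 (φ z)) then hs.choose else 0
  have hg : ∀ᵐ s ∂μ, ∀ φ : StrongDual ℝ X,
      Tendsto (fun i => φ (h (ns i) s)) atTop (𝓝 (φ (g s))) := by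
    filter_upwards [hweak] with s hs
    simp only [g, dif_pos hs]
    exact hs.choose_spec
  -- Closed convex sets are weakly closed: a functional strictly separating `g s` from `F s` would
  -- contradict weak convergence.
  have hgF : ∀ᵐ s ∂μ, g s ∈ F s := by
    filter_upwards [hg, hsel] with s h1 h2
    by_contra h3
    obtain ⟨φ, c, hφ, hc⟩ := geometric_hahn_banach_closed_point (hconv s) (hcl s) h3
    exact absurd (le_of_tendsto (h1 φ) (.of_forall fun i => (hφ _ (h2 i)).le)) (not_le.2 hc)
  have hgmeas : AEMeasurable g μ := by
    refine (measurableEmbedding_of_denseRange_dual hf).aemeasurable_comp_iff.1 ?_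
    refine aemeasurable_pi_lambda _ fun j => ?_
    refine aemeasurable_of_tendsto_metrizable_ae' (f := fun i s => f j (h (ns i) s)) (fun i =>
      (f j).continuous.measurable.comp_aemeasurable (hhC (ns i)).1.aemeasurable) ?_
    filter_upwards [hg] with s hs using hs (f j)
  have hgint : Integrable g μ := by
    refine .of_bound hgmeas.aestronglyMeasurable R ?_
    filter_upwards [hgF] with s hs using hR s _ hs
  refine ⟨g, hgint, hgF, ?_⟩
  have hlimy : Tendsto (fun i => ∫ s in A, h (ns i) s ∂μ) atTop (𝓝 y) := by
    rw [tendsto_iff_norm_sub_tendsto_zero]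
    refine squeeze_zero (fun _ => norm_nonneg _) (fun i => (hhC (ns i)).2.2) ?_
    exact tendsto_one_div_add_atTop_nhds_zero_nat.comp hns.tendsto_atTop
  rw [SeparatingDual.eq_iff_forall_dual_eq (R := ℝ)]
  intro φ
  refine tendsto_nhds_unique (f := fun i => φ (∫ s in A, h (ns i) s ∂μ)) (l := atTop) ?_
    ((φ.continuous.tendsto _).comp hlimy)
  have h1 : ∀ k : S → X, Integrable k μ → φ (∫ s in A, k s ∂μ) = ∫ s in A, φ (k s) ∂μ :=
    fun k hk => (φ.integral_comp_comm hk.integrableOn).symm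
  rw [h1 g hgint]
  simp_rw [fun i => h1 _ (hhC (ns i)).1]
  refine tendsto_integral_of_dominated_convergence (fun _ => ‖φ‖ * R) (fun i =>
    φ.continuous.comp_aestronglyMeasurable (hhC (ns i)).1.aestronglyMeasurable.restrict)
    (integrable_const _) (fun i => ?_) ?_
  · filter_upwards [ae_restrict_of_ae (hhC (ns i)).2.1] with s hs
    exact (φ.le_opNorm _).trans (by gcongr; exact hR s _ hs)
  · filter_upwards [ae_restrict_of_ae hg] with s hs using hs φ

/-! ### Support functions and measurability of the parametrized integral -/

/-- In a separable metric space, measurability of a set-valued map may be tested on balls. -/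
theorem isMeasurableSetMap_of_ball {S X : Type*} [m : MeasurableSpace S] [MetricSpace X]
    [TopologicalSpace.SeparableSpace X] {F : S → Set X}
    (hF : ∀ (x : X) (r : ℝ), 0 < r → MeasurableSet {s | (F s ∩ Metric.ball x r).Nonempty}) :
    IsMeasurableSetMap m F := by
  intro O hO
  rcases isEmpty_or_nonempty X with hX | hX
  · convert MeasurableSet.empty (α := S) using 1
    ext s
    simp [Set.eq_empty_of_isEmpty]
  let d := TopologicalSpace.denseSeq X
  have hd : DenseRange d := TopologicalSpace.denseRange_denseSeq X
  have hcov : {s | (F s ∩ O).Nonempty} = ⋃ (n : ℕ) (k : ℕ)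
      (_ : Metric.ball (d n) (1 / ((k : ℝ) + 1)) ⊆ O),
      {s | (F s ∩ Metric.ball (d n) (1 / ((k : ℝ) + 1))).Nonempty} := by
    ext s
    simp only [mem_iUnion, mem_ofPred_eq, exists_prop]
    constructor
    · rintro ⟨y, hyF, hyO⟩
      obtain ⟨ε, hε, hball⟩ := Metric.isOpen_iff.1 hO y hyO
      obtain ⟨k, hk⟩ := exists_nat_one_div_lt (show 0 < ε / 2 by positivity)
      obtain ⟨n, hn⟩ := hd.exists_dist_lt y (show 0 < 1 / ((k : ℝ) + 1) by positivity)
      refine ⟨n, k, fun z hz => hball ?_, y, hyF, hn⟩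
      rw [Metric.mem_ball] at hz ⊢
      have := dist_triangle_right z y (d n)
      linarith
    · rintro ⟨n, k, hsub, y, hyF, hy⟩
      exact ⟨y, hyF, hsub hy⟩
  rw [hcov]
  exact .iUnion fun n => .iUnion fun k => .iUnion fun _ => hF _ _ (by positivity)

section SupportFunction

variable {X : Type*} [NormedAddCommGroup X] [NormedSpace ℝ X]

theorem bddAbove_dual_image (f : StrongDual ℝ X) {C : Set X} {R : ℝ} (hR : ∀ x ∈ C, ‖x‖ ≤ R) :
    BddAbove (f '' C) := by
  refine ⟨‖f‖ * R, ?_⟩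
  rintro _ ⟨x, hx, rfl⟩
  exact (le_abs_self _).trans ((f.le_opNorm x).trans (by gcongr; exact hR x hx))

theorem abs_sSup_dual_image_le (f : StrongDual ℝ X) {C : Set X} (hne : C.Nonempty) {R : ℝ}
    (hR : ∀ x ∈ C, ‖x‖ ≤ R) : |sSup (f '' C)| ≤ ‖f‖ * R := by
  have hb : ∀ x ∈ C, |f x| ≤ ‖f‖ * R := fun x hx =>
    (f.le_opNorm x).trans (by gcongr; exact hR x hx)
  rw [abs_le]
  constructor
  · obtain ⟨x, hx⟩ := hne
    exact (abs_le.1 (hb x hx)).1.trans (le_csSup (bddAbove_dual_image f hR) ⟨x, hx, rfl⟩)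
  · refine csSup_le (hne.image _) ?_
    rintro _ ⟨x, hx, rfl⟩
    exact (abs_le.1 (hb x hx)).2

/-- The support function of a bounded measurable set-valued map is measurable. -/
theorem IsMeasurableSetMap.measurable_sSup_dual_image {S : Type*} [m : MeasurableSpace S]
    {F : S → Set X} (hF : IsMeasurableSetMap m F) (hne : ∀ s, (F s).Nonempty) {R : ℝ}
    (hR : ∀ s, ∀ x ∈ F s, ‖x‖ ≤ R) (f : StrongDual ℝ X) :
    Measurable fun s => sSup (f '' F s) := by
  refine measurable_of_Ioi fun q => ?_
  -- The supremum exceeds `q` exactly when the set meets the open half-space `f > q`.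
  convert hF (f ⁻¹' Ioi q) (isOpen_Ioi.preimage f.continuous) using 1
  ext s
  rw [mem_preimage, mem_Ioi, lt_csSup_iff (bddAbove_dual_image f (hR s)) ((hne s).image _)]
  simp only [exists_mem_image]
  rfl

theorem le_integral_sSup_of_mem_aumannIntegral [CompleteSpace X] {S : Type*}
    [m : MeasurableSpace S] (μ : Measure S) [IsFiniteMeasure μ] {F : S → Set X}
    (hF : IsMeasurableSetMap m F) (hne : ∀ s, (F s).Nonempty) {R : ℝ}
    (hR : ∀ s, ∀ x ∈ F s, ‖x‖ ≤ R) (A : Set S) (f : StrongDual ℝ X) {y : X}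
    (hy : y ∈ aumannIntegral μ F A) : f y ≤ ∫ s in A, sSup (f '' F s) ∂μ := by
  obtain ⟨g, hg, hgF, rfl⟩ := hy
  rw [← f.integral_comp_comm hg.integrableOn]
  refine integral_mono_ae (f.integrable_comp hg.integrableOn)
    (.of_bound (hF.measurable_sSup_dual_image hne hR f).aestronglyMeasurable (‖f‖ * R)
      (.of_forall fun s => abs_sSup_dual_image_le f (hne s) (hR s))) ?_
  filter_upwards [ae_restrict_of_ae hgF] with s hs
  exact le_csSup (bddAbove_dual_image f (hR s)) ⟨_, hs, rfl⟩

/-- Together with `le_integral_sSup_of_mem_aumannIntegral`: the support function of the Aumann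
integral is the integral of the support functions. -/
theorem exists_mem_aumannIntegral_integral_sSup_sub_le [CompleteSpace X]
    [TopologicalSpace.SeparableSpace X] {S : Type*}
    [m : MeasurableSpace S] (μ : Measure S) [IsFiniteMeasure μ] {F : S → Set X}
    (hF : IsMeasurableSetMap m F) (hne : ∀ s, (F s).Nonempty) (hcl : ∀ s, IsClosed (F s)) {R : ℝ}
    (hR : ∀ s, ∀ x ∈ F s, ‖x‖ ≤ R) (A : Set S) (f : StrongDual ℝ X) {ε : ℝ} (hε : 0 < ε) :
    ∃ y ∈ aumannIntegral μ F A, ∫ s in A, sSup (f '' F s) ∂μ - ε ≤ f y := by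
  have : SecondCountableTopology X := UniformSpace.secondCountable_of_separable X
  borelize X
  set σ : S → ℝ := fun s => sSup (f '' F s) with hσ
  have hσm : Measurable σ := hF.measurable_sSup_dual_image hne hR f
  have hσi : IntegrableOn σ A μ := Integrable.of_bound hσm.aestronglyMeasurable (‖f‖ * R)
      (.of_forall fun s => abs_sSup_dual_image_le f (hne s) (hR s))
  -- Losing `δ` pointwise costs at most `ε` after integration; the `+ 1` covers `μ.real A = 0`.
  set δ : ℝ := ε / (μ.real A + 1) with hδ
  have hA : 0 ≤ μ.real A := measureReal_nonneg
  have hδ0 : 0 < δ := by positivity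
  -- The strict inequality lets a rational `q` decouple the moving threshold from the open set. The
  -- closure, needed for the selection theorem, meets the same open sets and only weakens the
  -- inequality to `≤`.
  have hF' : IsMeasurableSetMap m (fun s => closure (F s ∩ f ⁻¹' Ioi (σ s - δ))) := by
    intro O hO
    have : {s | (closure (F s ∩ f ⁻¹' Ioi (σ s - δ)) ∩ O).Nonempty} =
        ⋃ q : ℚ, {s | (F s ∩ (O ∩ f ⁻¹' Ioi (q : ℝ))).Nonempty} ∩ {s | σ s - δ < q} := by
      ext s
      simp only [mem_ofPred_eq, mem_iUnion, mem_inter_iff]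
      rw [closure_inter_open_nonempty_iff hO]
      constructor
      · rintro ⟨y, ⟨hyF, hyf⟩, hyO⟩
        obtain ⟨q, hq1, hq2⟩ := exists_rat_btwn (show σ s - δ < f y from hyf)
        exact ⟨q, ⟨y, hyF, hyO, hq2⟩, hq1⟩
      · rintro ⟨q, ⟨y, hyF, hyO, hq2⟩, hq1⟩
        exact ⟨y, ⟨hyF, hq1.trans hq2⟩, hyO⟩
    rw [this]
    exact .iUnion fun q => (hF _ (hO.inter (isOpen_Ioi.preimage f.continuous))).inter
      (measurableSet_lt (hσm.sub_const δ) measurable_const)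
  obtain ⟨g, hgm, hg⟩ := hF'.exists_measurable_selection
    (fun s => by
      obtain ⟨_, ⟨y, hy, rfl⟩, hlt⟩ := exists_lt_of_lt_csSup ((hne s).image f)
        (sub_lt_self (σ s) hδ0)
      exact ⟨y, subset_closure ⟨hy, hlt⟩⟩) (fun s => isClosed_closure)
  have hgF : ∀ s, g s ∈ F s := fun s =>
    closure_minimal inter_subset_left (hcl s) (hg s)
  have hgf : ∀ s, σ s - δ ≤ f (g s) := fun s =>
    closure_minimal (t := f ⁻¹' Ici (σ s - δ)) (fun y hy => le_of_lt (show σ s - δ < f y from hy.2))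
      (isClosed_Ici.preimage f.continuous) (hg s)
  have hgi : Integrable g μ := .of_bound hgm.aestronglyMeasurable R
    (.of_forall fun s => hR s _ (hgF s))
  refine ⟨_, ⟨g, hgi, .of_forall hgF, rfl⟩, ?_⟩
  rw [← f.integral_comp_comm hgi.integrableOn]
  have h1 : ∫ s in A, (σ s - δ) ∂μ ≤ ∫ s in A, f (g s) ∂μ :=
    integral_mono (hσi.sub (integrable_const δ)) (f.integrable_comp hgi.integrableOn) hgf
  rw [integral_sub hσi (integrable_const δ), setIntegral_const, smul_eq_mul] at h1
  have h2 : μ.real A * δ ≤ ε := by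
    rw [hδ, mul_div_assoc', div_le_iff₀ (by positivity)]
    nlinarith
  linarith

/-- A bounded convex set meets an open ball iff its support function satisfies countably many
inequalities. -/
theorem Convex.nonempty_inter_ball_iff {C : Set X} (hC : Convex ℝ C) {R : ℝ}
    (hR : ∀ x ∈ C, ‖x‖ ≤ R) {ι : Type*} {f : ι → StrongDual ℝ X} (hf : DenseRange f) {σ : ι → ℝ}
    (hσ : ∀ j, ∀ c ∈ C, f j c ≤ σ j) (hσ' : ∀ j, ∀ ε > 0, ∃ c ∈ C, σ j - ε ≤ f j c)
    (x : X) {r : ℝ} (hr : 0 < r) :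
    (C ∩ Metric.ball x r).Nonempty ↔
      ∃ k : ℕ, ∀ j, f j x - (r - 1 / ((k : ℝ) + 1)) * ‖f j‖ ≤ σ j := by
  constructor
  · rintro ⟨c, hc, hcr⟩
    rw [mem_ball_iff_norm'] at hcr
    obtain ⟨k, hk⟩ := exists_nat_one_div_lt (sub_pos.2 hcr)
    refine ⟨k, fun j => ?_⟩
    have h1 : f j x - f j c ≤ ‖f j‖ * ‖x - c‖ := by
      rw [← map_sub]
      exact (le_abs_self _).trans ((f j).le_opNorm _)
    have h2 : ‖f j‖ * ‖x - c‖ ≤ (r - 1 / ((k : ℝ) + 1)) * ‖f j‖ := by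
      rw [mul_comm]
      gcongr
      linarith
    linarith [hσ j c hc]
  · rintro ⟨k, hk⟩
    by_contra hempty
    have hdisj : Disjoint (Metric.ball x r) C := by
      rw [disjoint_comm, disjoint_iff_inter_eq_empty]
      exact not_nonempty_iff_eq_empty.1 hempty
    obtain ⟨g, v, hg1, hg2⟩ := geometric_hahn_banach_open (convex_ball x r) Metric.isOpen_ball hC
      hdisj
    -- The supremum of `g` over the ball is `g x + r * ‖g‖`, and the separation bounds it by `v`.
    have hnorm : r * ‖g‖ ≤ v - g x := by
      refine le_of_forall_lt fun c hc => ?_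
      rw [mul_comm, ← div_lt_iff₀ hr] at hc
      obtain ⟨z, hz1, hz2⟩ := g.exists_lt_apply_of_lt_opNorm hc
      rw [div_lt_iff₀ hr, mul_comm] at hz2
      have hball : ∀ t : ℝ, |t| = 1 → g (x + (r * t) • z) < v := by
        intro t ht
        refine hg1 _ ?_
        rw [mem_ball_iff_norm, add_sub_cancel_left, norm_smul, norm_mul, Real.norm_eq_abs,
          Real.norm_eq_abs, ht, mul_one, abs_of_pos hr]
        exact mul_lt_of_lt_one_right hr hz1
      have hp := hball 1 (by simp)
      have hm := hball (-1) (by simp)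
      simp only [map_add, map_smul, smul_eq_mul] at hp hm
      rw [Real.norm_eq_abs] at hz2
      rcases abs_cases (g z) with ⟨h, -⟩ | ⟨h, -⟩ <;> rw [h] at hz2 <;> linarith
    have hgx := hg1 x (Metric.mem_ball_self hr)
    obtain ⟨j₀, -⟩ := hf.exists_dist_lt 0 one_pos
    obtain ⟨c₀, hc₀, -⟩ := hσ' j₀ 1 one_pos
    have hgpos : 0 < ‖g‖ := by
      rw [norm_pos_iff]
      rintro rfl
      have := hg2 c₀ hc₀
      simp at hgx this
      linarith
    have hR0 : 0 ≤ R := (norm_nonneg _).trans (hR c₀ hc₀)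
    set q := r - 1 / ((k : ℝ) + 1) with hq
    have hqr : 0 < r - q := by rw [hq, sub_sub_cancel]; positivity
    -- `M` collects the errors of replacing `-g` by `f j` at `c`, at `x` and in the norm (`q` may be
    -- negative), plus the slack in `σ j`. The total `η * M` is half of the gap `(r - q) * ‖g‖`.
    set M := R + ‖x‖ + |q| + 1 with hM
    have hM0 : 0 < M := by positivity
    set η := (r - q) * ‖g‖ / (2 * M) with hη
    have hη0 : 0 < η := by positivity
    obtain ⟨j, hj⟩ := hf.exists_dist_lt (-g) hη0
    rw [dist_eq_norm] at hj
    obtain ⟨c, hc, hcσ⟩ := hσ' j η hη0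
    have hap : ∀ z, |-g z - f j z| ≤ η * ‖z‖ := fun z =>
      ((-g - f j).le_opNorm z).trans (by gcongr)
    have h1 := (abs_le.1 (hap c)).1
    have h2 := (abs_le.1 (hap x)).2
    have h3 : η * ‖c‖ ≤ η * R := by gcongr; exact hR c hc
    have h4 : q * ‖f j‖ ≤ q * ‖g‖ + |q| * η := by
      have h5 : |‖f j‖ - ‖g‖| ≤ η := by
        have := abs_norm_sub_norm_le (f j) (-g)
        rw [norm_neg, norm_sub_rev] at this
        linarith
      have h6 : q * (‖f j‖ - ‖g‖) ≤ |q| * η := by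
        refine (le_abs_self _).trans ?_
        rw [abs_mul]
        gcongr
      linarith
    have h7 := hk j
    have h8 := hg2 c hc
    have h9 : η * M = (r - q) * ‖g‖ / 2 := by rw [hη]; field_simp
    rw [hM] at h9
    have h10 : 0 < (r - q) * ‖g‖ := by positivity
    linarith

/-- The parametrized Aumann integral of a jointly measurable map is measurable. -/
theorem isMeasurableSetMap_aumannIntegral [CompleteSpace X]
    [TopologicalSpace.SeparableSpace (StrongDual ℝ X)] {Ω S : Type*} [m : MeasurableSpace Ω]
    [MeasurableSpace S] (μ : Measure S) [IsFiniteMeasure μ] {G : Ω → S → Set X}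
    (hG : IsMeasurableSetMap (inferInstance : MeasurableSpace (Ω × S)) fun p => G p.1 p.2)
    (hne : ∀ ω s, (G ω s).Nonempty) (hcl : ∀ ω s, IsClosed (G ω s))
    (hconv : ∀ ω s, Convex ℝ (G ω s)) {R : ℝ} (hR : ∀ ω s, ∀ x ∈ G ω s, ‖x‖ ≤ R) (A : Set S) :
    IsMeasurableSetMap m fun ω => aumannIntegral μ (G ω) A := by
  have : TopologicalSpace.SeparableSpace X := separableSpace_of_separableSpace_dual
  let f := TopologicalSpace.denseSeq (StrongDual ℝ X)
  have hf : DenseRange f := TopologicalSpace.denseRange_denseSeq _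
  have hsec : ∀ ω, IsMeasurableSetMap inferInstance (G ω) := fun ω O hO =>
    measurable_prodMk_left (x := ω) (hG O hO)
  have hmeas : ∀ j, Measurable fun ω => ∫ s in A, sSup (f j '' G ω s) ∂μ := fun j =>
    (hG.measurable_sSup_dual_image (fun p => hne p.1 p.2) (fun p => hR p.1 p.2)
      (f j)).stronglyMeasurable.integral_prod_right.measurable
  refine isMeasurableSetMap_of_ball fun x r hr => ?_
  have hiff := fun ω => (convex_aumannIntegral μ (hconv ω) A).nonempty_inter_ball_iff
    (fun y hy => norm_le_of_mem_aumannIntegral μ (hR ω) A hy) hf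
    (fun j c hc => le_integral_sSup_of_mem_aumannIntegral μ (hsec ω) (hne ω) (hR ω) A (f j) hc)
    (fun j ε hε => exists_mem_aumannIntegral_integral_sSup_sub_le μ (hsec ω) (hne ω) (hcl ω)
      (hR ω) A (f j) hε) x hr
  simp_rw [hiff, ofPred_exists, ofPred_forall]
  exact .iUnion fun k => .iInter fun j => measurableSet_le measurable_const (hmeas j)

end SupportFunction

/-! ### From predictable to jointly measurable -/

/-- The largest point strictly to the left of `t` of the grid of step `1 / (n + 1)` starting at
`t₀`, projected to `[t₀, T]`; `k` is the index of the grid cell of `t`. -/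
noncomputable def leftGridPoint {t₀ T : ℝ} (h : t₀ ≤ T) (n : ℕ) (k : ℤ) : Icc t₀ T :=
  projIcc t₀ T h (t₀ + ((k : ℝ) - 1) / ((n : ℝ) + 1))

/-- The index of the cell of the grid of step `1 / (n + 1)` starting at `t₀` that contains `t`. -/
noncomputable def gridIndex {t₀ T : ℝ} (n : ℕ) (t : Icc t₀ T) : ℤ :=
  ⌈((t : ℝ) - t₀) * ((n : ℝ) + 1)⌉

theorem measurable_gridIndex {t₀ T : ℝ} (n : ℕ) :
    Measurable (gridIndex n : Icc t₀ T → ℤ) :=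
  Int.measurable_ceil.comp ((measurable_subtype_coe.sub_const t₀).mul_const _)

/-- Nothing lies to the left of `t₀`, so left-continuity is void there; projecting the grid point
back to the interval makes the approximation exact. -/
theorem leftGridPoint_gridIndex_left {t₀ T : ℝ} (h : t₀ ≤ T) (n : ℕ) {t : Icc t₀ T}
    (ht : (t : ℝ) = t₀) : leftGridPoint h n (gridIndex n t) = t := by
  have h1 : gridIndex n t = 0 := by simp [gridIndex, ht]
  rw [leftGridPoint, h1, projIcc_of_le_left]
  · exact Subtype.ext ht.symm
  · have : (0 : ℝ) ≤ 1 / ((n : ℝ) + 1) := by positivity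
    rw [Int.cast_zero, zero_sub, neg_div]
    linarith

/-- The ceiling makes cells open on the left and closed on the right, so the left end of the cell is
strictly below `t`, by at most `1 / (n + 1)`. -/
theorem tendsto_leftGridPoint_gridIndex {t₀ T : ℝ} (h : t₀ ≤ T) {t : Icc t₀ T}
    (ht : t₀ < (t : ℝ)) :
    Tendsto (fun n => leftGridPoint h n (gridIndex n t)) atTop (𝓝[<] t) := by
  have hval : ∀ n, (leftGridPoint h n (gridIndex n t) : ℝ) < t ∧
      (t : ℝ) - 1 / ((n : ℝ) + 1) ≤ leftGridPoint h n (gridIndex n t) := by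
    intro n
    have hn : (0 : ℝ) < (n : ℝ) + 1 := by positivity
    have h1 := Int.ceil_lt_add_one (((t : ℝ) - t₀) * ((n : ℝ) + 1))
    have h2 := Int.le_ceil (((t : ℝ) - t₀) * ((n : ℝ) + 1))
    have h3 : (1 : ℝ) ≤ (gridIndex n t : ℝ) := by
      have : 0 < gridIndex n t := Int.ceil_pos.2 (mul_pos (sub_pos.2 ht) hn)
      exact_mod_cast this
    change ((gridIndex n t : ℤ) : ℝ) < _ at h1
    change _ ≤ ((gridIndex n t : ℤ) : ℝ) at h2
    have h4 : ((gridIndex n t : ℝ) - 1) / ((n : ℝ) + 1) < t - t₀ := by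
      rw [div_lt_iff₀ hn]
      linarith
    have h5 : (t : ℝ) - t₀ - 1 / ((n : ℝ) + 1) ≤
        ((gridIndex n t : ℝ) - 1) / ((n : ℝ) + 1) := by
      rw [sub_div]
      have := (le_div_iff₀ hn).2 h2
      linarith
    have h6 : 0 ≤ ((gridIndex n t : ℝ) - 1) / ((n : ℝ) + 1) :=
      div_nonneg (by linarith) hn.le
    have hmem : t₀ + ((gridIndex n t : ℝ) - 1) / ((n : ℝ) + 1) ∈ Icc t₀ T :=
      ⟨by linarith, by linarith [t.2.2]⟩
    rw [leftGridPoint, projIcc_of_mem h hmem]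
    constructor <;> dsimp only <;> linarith
  refine tendsto_nhdsWithin_iff.2 ⟨?_, .of_forall fun n => (hval n).1⟩
  rw [tendsto_subtype_rng]
  refine tendsto_of_tendsto_of_tendsto_of_le_of_le (g := fun n : ℕ => (t : ℝ) - 1 / ((n : ℝ) + 1))
    ?_ tendsto_const_nhds (fun n => (hval n).2) (fun n => (hval n).1.le)
  simpa using (tendsto_const_nhds (x := (t : ℝ))).sub tendsto_one_div_add_atTop_nhds_zero_nat

theorem nonempty_inter_ball_iff_infEDist_lt {X : Type*} [PseudoMetricSpace X] {C : Set X} {x : X}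
    {r : ℝ} : (C ∩ Metric.ball x r).Nonempty ↔ Metric.infEDist x C < ENNReal.ofReal r := by
  rw [Metric.infEDist_lt_iff]
  refine exists_congr fun y => and_congr_right fun _ => ?_
  rw [Metric.mem_ball', edist_lt_ofReal]

/-- The distance from a fixed point is 1-Lipschitz in the set for the Hausdorff distance.
Non-emptiness of `D` keeps the limit finite, as the truncated subtraction requires. -/
theorem tendsto_infEDist_of_tendsto_hausdorffEDist {X ι : Type*} [PseudoMetricSpace X]
    {l : Filter ι} {C : ι → Set X} {D : Set X} (hD : D.Nonempty)
    (h : Tendsto (fun i => Metric.hausdorffEDist (C i) D) l (𝓝 0)) (x : X) :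
    Tendsto (fun i => Metric.infEDist x (C i)) l (𝓝 (Metric.infEDist x D)) := by
  have hfin : Metric.infEDist x D ≠ ∞ := Metric.infEDist_ne_top hD
  refine tendsto_of_tendsto_of_tendsto_of_le_of_le
    (g := fun i => Metric.infEDist x D - Metric.hausdorffEDist (C i) D)
    (h := fun i => Metric.infEDist x D + Metric.hausdorffEDist (C i) D) ?_ ?_ ?_ ?_
  · simpa using ENNReal.Tendsto.sub (tendsto_const_nhds (x := Metric.infEDist x D)) h
      (Or.inl hfin)
  · simpa using (tendsto_const_nhds (x := Metric.infEDist x D)).add h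
  · exact fun i => tsub_le_iff_right.2 Metric.infEDist_le_infEDist_add_hausdorffEDist
  · intro i
    dsimp only
    rw [Metric.hausdorffEDist_comm]
    exact Metric.infEDist_le_infEDist_add_hausdorffEDist

/-- A set-valued process with measurable coordinates and left-continuous trajectories is jointly
measurable. -/
theorem isMeasurableSetMap_of_leftContinuous {X Ω : Type*} [MetricSpace X]
    [TopologicalSpace.SeparableSpace X] {t₀ T : ℝ} [m : MeasurableSpace Ω]
    {H : Ω → Icc t₀ T → Set X} (hmeas : ∀ t, IsMeasurableSetMap m fun ω => H ω t)
    (hne : ∀ ω t, (H ω t).Nonempty)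
    (hleft : ∀ ω u, Tendsto (fun t => Metric.hausdorffEDist (H ω t) (H ω u)) (𝓝[<] u) (𝓝 0)) :
    IsMeasurableSetMap (inferInstance : MeasurableSpace (Ω × Icc t₀ T)) fun p => H p.1 p.2 := by
  rcases lt_or_ge T t₀ with hT | hT
  · have : IsEmpty (Icc t₀ T) := by rw [Icc_eq_empty_of_lt hT]; infer_instance
    intro O _
    rw [Set.eq_empty_of_isEmpty {p : Ω × Icc t₀ T | (H p.1 p.2 ∩ O).Nonempty}]
    exact .empty
  refine isMeasurableSetMap_of_ball fun x r _ => ?_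
  have hcoord : ∀ t, Measurable fun ω => Metric.infEDist x (H ω t) := by
    refine fun t => measurable_of_Iio fun r => ?_
    convert hmeas t (Metric.eball x r) Metric.isOpen_eball using 1
    ext ω
    rw [mem_preimage, mem_Iio, Metric.infEDist_lt_iff]
    refine exists_congr fun y => and_congr_right fun _ => ?_
    rw [Metric.mem_eball']
  have happrox : ∀ n, Measurable fun p : Ω × Icc t₀ T =>
      Metric.infEDist x (H p.1 (leftGridPoint hT n (gridIndex n p.2))) := by
    intro n
    -- For fixed `n` only countably many times occur, so measurability in `ω` at each time suffices.
    have h1 : Measurable fun p : Ω × ℤ => Metric.infEDist x (H p.1 (leftGridPoint hT n p.2)) :=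
      measurable_from_prod_countable_left fun k => hcoord (leftGridPoint hT n k)
    have h2 : Measurable fun p : Ω × Icc t₀ T => (p.1, gridIndex n p.2) :=
      measurable_fst.prodMk ((measurable_gridIndex n).comp measurable_snd)
    exact h1.comp h2
  have hlim : Measurable fun p : Ω × Icc t₀ T => Metric.infEDist x (H p.1 p.2) := by
    refine measurable_of_tendsto_metrizable happrox (tendsto_pi_nhds.2 fun p => ?_)
    refine tendsto_infEDist_of_tendsto_hausdorffEDist (hne _ _) ?_ x
    rcases eq_or_lt_of_le p.2.2.1 with h0 | h0
    · simp_rw [fun n => leftGridPoint_gridIndex_left hT n h0.symm, Metric.hausdorffEDist_self]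
      exact tendsto_const_nhds
    · exact (hleft p.1 p.2).comp (tendsto_leftGridPoint_gridIndex hT h0)
  simp_rw [nonempty_inter_ball_iff_infEDist_lt]
  exact measurableSet_lt hlim measurable_const

/-- Over a complete probability space, a predictable set is jointly measurable up to a null set
of scenarios. -/
theorem exists_null_measurableSet_of_predictable {X Ω : Type*} [NormedAddCommGroup X]
    [TopologicalSpace.SeparableSpace X] {t₀ T : ℝ} [m : MeasurableSpace Ω] {P : Measure Ω}
    [P.IsComplete] {𝓕 : Filtration (Icc t₀ T) m} {A : Set (Ω × Icc t₀ T)}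
    (hA : MeasurableSet[predictableSigmaAlgebra X 𝓕 P] A) :
    ∃ N : Set Ω, P N = 0 ∧ MeasurableSet (A ∩ Nᶜ ×ˢ univ) := by
  classical
  have hprod : ∀ N : Set Ω, P N = 0 → MeasurableSet (Nᶜ ×ˢ (univ : Set (Icc t₀ T))) :=
    fun N hN => (Measure.IsComplete.out ‹P.IsComplete› N hN).compl.prod .univ
  -- Being jointly measurable off a null set of scenarios is stable under complements and countable
  -- unions, so only the generators need work.
  induction A, hA using MeasurableSpace.generateFrom_induction with
  | hC A hA _ =>
    obtain ⟨H, O, hH, hO, rfl⟩ := hA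
    let N : Set Ω := {ω | ¬ ∀ u, Tendsto (fun t => Metric.hausdorffEDist (H ω t) (H ω u))
      (𝓝[<] u) (𝓝 0)}
    have hN : P N = 0 := ae_iff.1 hH.leftContinuous
    have hNm : MeasurableSet N := Measure.IsComplete.out ‹P.IsComplete› N hN
    let H' : Ω → Icc t₀ T → Set X := fun ω t => if ω ∈ N then {0} else H ω t
    have hH' : IsMeasurableSetMap inferInstance fun p : Ω × Icc t₀ T => H' p.1 p.2 := by
      refine isMeasurableSetMap_of_leftContinuous (fun t O hO => ?_) (fun ω t => ?_)
        fun ω u => ?_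
      · have : {ω | (H' ω t ∩ O).Nonempty} =
            N.ite {_ω | (({0} : Set X) ∩ O).Nonempty} {ω | (H ω t ∩ O).Nonempty} := by
          ext ω
          by_cases hω : ω ∈ N <;> simp [H', hω, Set.ite]
        rw [this]
        exact hNm.ite (.const _) (𝓕.le t _ ((hH.adapted t).measurable O hO))
      · by_cases hω : ω ∈ N
        · simp [H', hω]
        · simpa [H', hω] using (hH.adapted t).nonempty ω
      · by_cases hω : ω ∈ N
        · simpa [H', hω] using tendsto_const_nhds
        · simpa [H', hω] using not_not.1 hω u
    refine ⟨N, hN, ?_⟩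
    convert (hH' O hO).inter (hprod N hN) using 1
    ext p
    simp only [mem_inter_iff, mem_ofPred_eq, mem_prod, mem_compl_iff, mem_univ, and_true]
    refine and_congr_left fun hp => ?_
    simp [H', hp]
  | empty => exact ⟨∅, by simp⟩
  | compl A _ ih =>
    obtain ⟨N, hN, hm⟩ := ih
    refine ⟨N, hN, ?_⟩
    convert (hprod N hN).diff hm using 1
    ext p
    simp only [mem_inter_iff, Set.mem_sdiff, mem_compl_iff]
    tauto
  | iUnion A _ ih =>
    choose N hN hm using ih
    refine ⟨⋃ i, N i, measure_iUnion_null hN, ?_⟩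
    have h1 : (⋃ i, A i) ∩ (⋃ i, N i)ᶜ ×ˢ univ =
        (⋃ i, A i ∩ (N i)ᶜ ×ˢ univ) ∩ (⋃ i, N i)ᶜ ×ˢ (univ : Set (Icc t₀ T)) := by
      ext p
      simp only [mem_inter_iff, mem_iUnion, mem_prod, mem_compl_iff, mem_univ, and_true]
      grind
    rw [h1]
    exact (MeasurableSet.iUnion hm).inter (hprod _ (measure_iUnion_null hN))

/-- Over a complete probability space, a predictable set-valued map is jointly measurable after it
has been changed to `{0}` on a null set of scenarios. -/
theorem exists_null_isMeasurableSetMap_of_predictable {X Ω : Type*} [NormedAddCommGroup X]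
    [TopologicalSpace.SeparableSpace X] {t₀ T : ℝ} [m : MeasurableSpace Ω] {P : Measure Ω}
    [P.IsComplete] {𝓕 : Filtration (Icc t₀ T) m} {G : Ω → Icc t₀ T → Set X}
    (hG : IsMeasurableSetMap (predictableSigmaAlgebra X 𝓕 P) fun p => G p.1 p.2) :
    ∃ N : Set Ω, P N = 0 ∧ ∀ G' : Ω → Icc t₀ T → Set X, (∀ ω ∈ N, ∀ t, G' ω t = {0}) →
      (∀ ω ∉ N, ∀ t, G' ω t = G ω t) →
      IsMeasurableSetMap (inferInstance : MeasurableSpace (Ω × Icc t₀ T)) fun p => G' p.1 p.2 := by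
  choose N hN hm using fun O : {O : Set X // IsOpen O} =>
    exists_null_measurableSet_of_predictable (hG O.1 O.2)
  have : SecondCountableTopology X := UniformSpace.secondCountable_of_separable X
  -- The exceptional null set depends on the open set; a countable basis provides one that serves
  -- for all.
  obtain ⟨b, hb, -, hbasis⟩ := TopologicalSpace.exists_countable_basis X
  let B : b → {O : Set X // IsOpen O} := fun O => ⟨O.1, hbasis.isOpen O.2⟩
  have := hb.to_subtype
  have hnull : P (⋃ O : b, N (B O)) = 0 := measure_iUnion_null fun O => hN (B O)
  refine ⟨⋃ O : b, N (B O), hnull, fun G' hG'N hG' O hO => ?_⟩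
  have hNm : MeasurableSet (⋃ O : b, N (B O)) := Measure.IsComplete.out ‹P.IsComplete› _ hnull
  have heq : {p : Ω × Icc t₀ T | (G' p.1 p.2 ∩ O).Nonempty} =
      ((⋃ O : b, N (B O)) ×ˢ univ ∩ {_p | (({0} : Set X) ∩ O).Nonempty}) ∪
      (⋃ (U : b) (_ : U.1 ⊆ O), ({p | (G p.1 p.2 ∩ U.1).Nonempty} ∩ (N (B U))ᶜ ×ˢ univ)) ∩
        (⋃ O : b, N (B O))ᶜ ×ˢ univ := by
    ext p
    by_cases hp : p.1 ∈ ⋃ O : b, N (B O)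
    · simp only [mem_union, mem_inter_iff, mem_prod, mem_compl_iff, mem_univ, and_true,
        mem_ofPred_eq, hG'N p.1 hp, hp, true_and, not_true, and_false, or_false]
    · simp only [mem_union, mem_inter_iff, mem_prod, mem_compl_iff, mem_univ, and_true,
        mem_ofPred_eq, hG' p.1 hp, hp, false_and, false_or, not_false_eq_true, mem_iUnion,
        exists_prop]
      constructor
      · rintro ⟨y, hyG, hyO⟩
        obtain ⟨U, hU, hyU, hUO⟩ := hbasis.exists_subset_of_mem_open hyO hO
        exact ⟨⟨U, hU⟩, hUO, ⟨y, hyG, hyU⟩, fun h => hp (mem_iUnion.2 ⟨_, h⟩)⟩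
      · rintro ⟨U, hUO, ⟨y, hyG, hyU⟩, -⟩
        exact ⟨y, hyG, hUO hyU⟩
  rw [heq]
  exact ((hNm.prod .univ).inter (.const _)).union
    ((MeasurableSet.iUnion fun U => .iUnion fun _ => hm (B U)).inter (hNm.compl.prod .univ))

/-! ### Orientation and conclusion -/

theorem IsMeasurableSetMap.neg {S X : Type*} {m : MeasurableSpace S} [NormedAddCommGroup X]
    {F : S → Set X} (hF : IsMeasurableSetMap m F) : IsMeasurableSetMap m fun s => -F s := by
  intro O hO
  convert hF (-O) hO.neg using 1
  ext s
  simp only [mem_ofPred_eq]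
  rw [← Set.nonempty_neg, Set.inter_neg, neg_neg]

instance isFiniteMeasure_lebesgueIcc (t₀ T : ℝ) : IsFiniteMeasure (lebesgueIcc t₀ T) := by
  refine ⟨?_⟩
  rw [lebesgueIcc, comap_subtype_coe_apply measurableSet_Icc, image_univ, Subtype.range_coe]
  exact measure_Icc_lt_top

theorem mainTheorem3
    {X : Type*} [NormedAddCommGroup X] [NormedSpace ℝ X] [CompleteSpace X]
    (hrefl : IsReflexiveSpace X) (hsep : TopologicalSpace.SeparableSpace (StrongDual ℝ X))
    {t₀ T : ℝ}
    {Ω : Type*} {m : MeasurableSpace Ω} (P : Measure Ω) [IsProbabilityMeasure P]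
    (𝓕 : Filtration (Icc t₀ T) m) (h𝓕 : HasUsualConditions 𝓕 P)
    (G : Ω → Icc t₀ T → Set X)
    (hclosed : ∀ ω t, IsClosed (G ω t))
    (hzero : ∀ ω t, (0 : X) ∈ G ω t)
    (hconvex : ∀ ω t, Convex ℝ (G ω t))
    (hbounded : ∃ K : Set X, K.Nonempty ∧ IsClosed K ∧ Bornology.IsBounded K ∧
      ∀ ω t, G ω t ⊆ K)
    (hpred : IsMeasurableSetMap (predictableSigmaAlgebra X 𝓕 P)
      (fun p : Ω × Icc t₀ T => G p.1 p.2))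
    (a b : Icc t₀ T) :
    (∀ ω, (aumannIntervalIntegral (G ω) a b).Nonempty) ∧
    IsMeasurableSetMap m (fun ω => aumannIntervalIntegral (G ω) a b) ∧
    IsRandomClosedSet m (fun ω => aumannIntervalIntegral (G ω) a b) ∧
    (∀ ω, Bornology.IsBounded (aumannIntervalIntegral (G ω) a b)) ∧
    (∀ ω, Convex ℝ (aumannIntervalIntegral (G ω) a b)) := by
  classical
  have : TopologicalSpace.SeparableSpace X := separableSpace_of_separableSpace_dual
  have hcomplete : P.IsComplete := ⟨fun s hs => 𝓕.le a s (h𝓕.null_mem a s hs)⟩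
  obtain ⟨K, -, -, hK, hGK⟩ := hbounded
  obtain ⟨R, hR⟩ := hK.exists_norm_le
  have hGR : ∀ ω t, ∀ x ∈ G ω t, ‖x‖ ≤ R := fun ω t x hx => hR x (hGK ω t hx)
  have hne (A : Set (Icc t₀ T)) (ω) : (aumannIntegral (lebesgueIcc t₀ T) (G ω) A).Nonempty :=
    ⟨0, zero_mem_aumannIntegral _ (hzero ω) A⟩
  have hcl (A : Set (Icc t₀ T)) (ω) : IsClosed (aumannIntegral (lebesgueIcc t₀ T) (G ω) A) :=
    isClosed_aumannIntegral hrefl _ (hclosed ω) (hconvex ω) (hGR ω) A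
  have hbdd (A : Set (Icc t₀ T)) (ω) :
      Bornology.IsBounded (aumannIntegral (lebesgueIcc t₀ T) (G ω) A) :=
    isBounded_iff_forall_norm_le.2 ⟨_, fun y hy => norm_le_of_mem_aumannIntegral _ (hGR ω) A hy⟩
  have hconv (A : Set (Icc t₀ T)) (ω) : Convex ℝ (aumannIntegral (lebesgueIcc t₀ T) (G ω) A) :=
    convex_aumannIntegral _ (hconvex ω) A
  have hmeas (A : Set (Icc t₀ T)) :
      IsMeasurableSetMap m fun ω => aumannIntegral (lebesgueIcc t₀ T) (G ω) A := by
    obtain ⟨N, hN, hNG⟩ := exists_null_isMeasurableSetMap_of_predictable hpred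
    let G' : Ω → Icc t₀ T → Set X := fun ω t => if ω ∈ N then {0} else G ω t
    have hG'N : ∀ ω ∈ N, ∀ t, G' ω t = {0} := fun ω hω t => if_pos hω
    have hG'G : ∀ ω ∉ N, ∀ t, G' ω t = G ω t := fun ω hω t => if_neg hω
    have hG' := isMeasurableSetMap_aumannIntegral (lebesgueIcc t₀ T) (hNG G' hG'N hG'G)
      (fun ω t => ⟨0, by by_cases hω : ω ∈ N <;> simp [G', hω, hzero]⟩)
      (fun ω t => by by_cases hω : ω ∈ N <;> simp [G', hω, hclosed])
      (fun ω t => by by_cases hω : ω ∈ N <;> simp [G', hω, hconvex])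
      (R := max R 0) (fun ω t x hx => by
        by_cases hω : ω ∈ N
        · rw [hG'N ω hω, mem_singleton_iff] at hx
          simp [hx]
        · rw [hG'G ω hω] at hx
          exact (hGR ω t x hx).trans (le_max_left _ _)) A
    intro O hO
    -- The integrals of `G` and `G'` agree outside `N`, so the two hitting sets differ by a null
    -- set, which is measurable by completeness.
    refine NullMeasurableSet.measurable_of_complete (μ := P)
      ((hG' O hO).nullMeasurableSet.congr ?_)
    filter_upwards [measure_eq_zero_iff_ae_notMem.1 hN] with ω hω
    have : G' ω = G ω := funext (hG'G ω hω)
    change (aumannIntegral _ (G' ω) A ∩ O).Nonempty = (aumannIntegral _ (G ω) A ∩ O).Nonempty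
    rw [this]
  unfold aumannIntervalIntegral
  split_ifs
  · exact ⟨hne _, hmeas _, ⟨hne _, hcl _, hmeas _⟩, hbdd _, hconv _⟩
  · exact ⟨fun ω => (hne _ ω).neg, (hmeas _).neg,
      ⟨fun ω => (hne _ ω).neg, fun ω => (hcl _ ω).neg, (hmeas _).neg⟩,
      fun ω => (hbdd _ ω).neg, fun ω => (hconv _ ω).neg⟩
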